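/- Let $\ell\in\mathbb N$ and let $\phi_1,\dots,\phi_\ell:\mathbb N\to\mathbb Z$ be adequate sequences, i.e. $\lim_{n\to\infty}|\phi_j(n)|=\infty$ for every $j\in\{1,\dots,\ell\}$, and for all $a_1,\dots,a_\ell\in\mathbb Z$ the limit $\lim_{n\to\infty}\bigl|\sum_{j=1}^\ell a_j\phi_j(n)\bigr|$ exists in $[0,\infty]$ and belongs to $\{0,\infty\}$. Let $$A(\phi_1,\dots,\phi_\ell)=\Bigl\{(a_1,\dots,a_\ell)\in\mathbb Z^\ell \;:\; \lim_{n\to\infty}\sum_{j=1}^\ell a_j\phi_j(n)=0\Bigr\},$$ which is a subgroup of $\mathbb Z^\ell$, let $\vec e_1,\dots,\vec e_\ell$ be the standard basis of $\mathbb Z^\ell$, let $F\subseteq\{1,\dots,\ell\}$, and let $\mathcal H$ be an infinite-dimensional complex Hilbert space. The following statements are equivalent: (a) There exists a finite index subgroup $H$ of $\mathbb Z^\ell$ with $A(\phi_1,\dots,\phi_\ell)\subseteq H$ such that for every $j\in\{1,\dots,\ell\}$, $j\in F$ if and only if $\vec e_j\in H$. (b) There exist a strictly increasing sequence $(n_k)_{k\in\mathbb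 N}$ in $\mathbb N$ and a unitary operator $U:\mathcal H\to\mathcal H$ such that for every $f\in\mathcal H$ and every $j\in\{1,\dots,\ell\}$, $$\lim_{k\to\infty}U^{\phi_j(n_k)}f=\begin{cases} f & \text{if } j\in F,\\ 0 & \text{if } j\notin F,\end{cases}$$ in the weak topology of $\mathcal H$. (c) For every $(a_1,\dots,a_\ell)\in A(\phi_1,\dots,\phi_\ell)$, either $\bigl|\{i\in\{1,\dots,\ell\} : a_i\neq 0\}\setminus F\bigr|\neq 1$, or the unique element $j$ of $\{i\in\{1,\dots,\ell\} : a_i\neq 0\}\setminus F$ satisfies $|a_j|\neq 1$. -/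

import Mathlib

open Filter Topology

/-- The sequences `φ 0, …, φ (ℓ - 1) : ℕ → ℤ` are adequate: each `|φ j n|` tends to infinity, and
for every integer vector `a` the limit of `|∑ j, a j * φ j n|` exists and is `0` or infinity. -/
def Adequate {ℓ : ℕ} (φ : Fin ℓ → ℕ → ℤ) : Prop :=
  (∀ j : Fin ℓ, Tendsto (fun n : ℕ => |φ j n|) atTop atTop) ∧
  ∀ a : Fin ℓ → ℤ,
    Tendsto (fun n : ℕ => |∑ j, a j * φ j n|) atTop (𝓝 0) ∨
    Tendsto (fun n : ℕ => |∑ j, a j * φ j n|) atTop atTop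

/-- The subgroup `A(φ)` of `ℤ^ℓ` of all `a` with `lim_n ∑ j, a j * φ j n = 0`. -/
def relationGroup {ℓ : ℕ} (φ : Fin ℓ → ℕ → ℤ) : AddSubgroup (Fin ℓ → ℤ) where
  carrier := {a | Tendsto (fun n : ℕ => ∑ j, a j * φ j n) atTop (𝓝 0)}
  zero_mem' := by simp
  add_mem' := by
    intro a b ha hb
    have h := Tendsto.add ha hb
    simpa [add_mul, Finset.sum_add_distrib] using h
  neg_mem' := by
    intro a ha
    have h := Tendsto.neg ha
    simpa [Finset.sum_neg_distrib] using h

/-!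
Condition (c) says exactly that some subgroup `L` of `ℤ^ℓ` containing `relationGroup φ`, the group
of relations, satisfies `j ∈ F ↔ e_j ∈ L` for all `j`
(`forall_card_ne_one_or_iff_exists_addSubgroup`; for the converse one takes the subgroup spanned by
the relations and the `e_j` with `j ∈ F`). The three statements are compared with this one.

* (a) is the same with `L` of finite index. An arbitrary `L` can be enlarged to one of finite index
  that still avoids the finitely many `e_j` with `j ∉ F`, as the finitely generated abelian group
  `ℤ^ℓ / L` is residually finite (`exists_finiteIndex_le_of_notMem`).
* Given (b), let `L` consist of the `a` for which `U ^ (∑ j, a j * φ j (n k))` tends strongly to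
  the identity. For unitary operators weak convergence to the identity is strong convergence, which
  makes `L` a subgroup containing `e_j` for `j ∈ F`; and a sequence tending weakly to `0` does not
  tend strongly to the identity (`exists_addSubgroup_of_tendsto_zpow`).
* Given `L`, a positive definite sequence `c : ℤ → ℂ` with `c 0 = 1` is constructed, such that
  `c (φ j (n k) + m)` tends to `c m` if `j ∈ F` and to `0` if `j ∉ F` (`Adequate.exists_posDef`).
  By the Gelfand-Naimark-Segal construction `c m = ⟪v, U ^ m v⟫` for a cyclic vector `v` of a
  unitary operator `U` on a separable space, and an orthogonal sum of as many copies of it as the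
  dimension of `H` acts on a space isomorphic to `H` (`IsPosDef.exists_unitary`). The limits of
  `⟪U ^ p v, U ^ (φ j (n k)) U ^ q v⟫ = c (φ j (n k) + q - p)` then give the weak limits in (b).

The sequence `c` consists of the Fourier coefficients of a generalized Riesz product
`∏ k, |T_k|⁻¹ * |∑ t ∈ T_k, z ^ (t · φ (n k))| ^ 2`, where `T_k` is a Følner set in the subgroup
spanned by the `e_j`, `j ∈ F`, of `ℤ^ℓ / relationGroup φ`, and `n k` grows fast. By adequacy the
frequencies of the `k`-th factor coincide or differ by far more than the degree of the product of
the earlier ones. Hence a new factor leaves the old coefficients unchanged, while near the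
frequency `φ j (n k)` they reappear, multiplied by the proportion of the `t ∈ T_k` with
`t + e_j ∈ T_k`. This proportion is close to `1` if `j ∈ F` by the Følner property, and it is `0`
if `j ∉ F`, because then `e_j` is not a difference of elements of `T_k`
(`Adequate.exists_posDef_step`).
-/

/-! ### Finitely generated abelian groups -/

/-- Finite sets in an abelian group that are almost invariant under finitely many translations
(Følner sets) exist inside the subgroup generated by these translations, since the boxes
`{∑ i ∈ F, c i • e i | c i ≤ N}` grow at most polynomially in `N`. -/
theorem exists_finset_almost_invariant {ι Q : Type*} [Fintype ι] [AddCommGroup Q]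
    [DecidableEq Q] (e : ι → Q) (F : Finset ι) {ε : ℝ} (hε : 0 < ε) :
    ∃ T : Finset Q, T.Nonempty ∧ (∀ t ∈ T, t ∈ AddSubgroup.closure (e '' F)) ∧
      ∀ j ∈ F, (1 - ε) * T.card ≤ (T.filter fun t => t + e j ∈ T).card := by
  classical
  let T : ℕ → Finset Q := fun N =>
    (Fintype.piFinset fun _ : ι => Finset.range (N + 1)).image fun c => ∑ i ∈ F, c i • e i
  have hne : ∀ N, (T N).Nonempty := fun N =>
    Finset.Nonempty.image ⟨0, by simp⟩ _
  have hmono : ∀ N, T N ⊆ T (N + 1) := fun N =>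
    Finset.image_subset_image (Fintype.piFinset_subset _ _ fun _ =>
      Finset.range_subset_range.2 (by omega))
  have hstep : ∀ N, ∀ j ∈ F, ∀ t ∈ T N, t + e j ∈ T (N + 1) := by
    intro N j hj t ht
    obtain ⟨c, hc, rfl⟩ := Finset.mem_image.1 ht
    refine Finset.mem_image.2 ⟨c + Pi.single j 1, ?_, ?_⟩
    · simp only [Fintype.mem_piFinset, Finset.mem_range] at hc ⊢
      intro i
      have := hc i
      by_cases h : i = j
      · subst h; simp; omega
      · simp [h]; omega
    · simp [add_smul, Finset.sum_add_distrib, Pi.single_apply, hj]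
  have hcard : ∀ N, (T N).card ≤ (N + 1) ^ Fintype.card ι := fun N => by
    refine Finset.card_image_le.trans ?_
    simp
  -- the sets grow polynomially, hence some step has small relative growth
  obtain ⟨N, hN⟩ : ∃ N, ((T (N + 1)).card : ℝ) ≤ (1 + ε) * (T N).card := by
    by_contra! hcon
    have hexp : ∀ N, (1 + ε) ^ N ≤ ((T N).card : ℝ) := by
      intro N
      induction N with
      | zero => simpa using Finset.card_pos.2 (hne 0)
      | succ N ih =>
        calc (1 + ε) ^ (N + 1) = (1 + ε) * (1 + ε) ^ N := by ring
          _ ≤ (1 + ε) * (T N).card := by gcongr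
          _ ≤ _ := (hcon N).le
    have hlim := (tendsto_pow_const_div_const_pow_of_one_lt (Fintype.card ι)
      (r := 1 + ε) (by linarith)).comp (tendsto_add_atTop_nat 1)
    have hpos : (0 : ℝ) < 1 / (1 + ε) := by positivity
    obtain ⟨N, hN⟩ := (hlim.eventually_lt_const hpos).exists
    have h1 : (1 + ε) ^ N ≤ ((N + 1 : ℕ) : ℝ) ^ Fintype.card ι := by
      refine (hexp N).trans ?_
      exact_mod_cast hcard N
    simp only [Function.comp] at hN
    rw [div_lt_div_iff₀ (by positivity) (by positivity), pow_succ] at hN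
    nlinarith
  refine ⟨T N, hne N, ?_, ?_⟩
  · intro t ht
    obtain ⟨c, hc, rfl⟩ := Finset.mem_image.1 ht
    exact sum_mem fun i hi =>
      nsmul_mem (AddSubgroup.subset_closure (Set.mem_image_of_mem e (Finset.mem_coe.2 hi))) _
  · intro j hj
    -- an element translated out of `T N` lands in `T (N + 1) \ T N`
    have h1 : ((T N).filter fun t => ¬ t + e j ∈ T N).card ≤ (T (N + 1) \ T N).card := by
      refine Finset.card_le_card_of_injOn (· + e j) ?_ (fun a _ b _ h => add_right_cancel h)
      intro t ht
      simp only [Finset.coe_filter, Set.mem_ofPred_eq] at ht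
      simpa using ⟨hstep N j hj t ht.1, ht.2⟩
    have h2 := Finset.card_filter_add_card_filter_not (s := T N) (fun t => t + e j ∈ T N)
    have h3 := Finset.card_sdiff_add_card_eq_card (hmono N)
    have h4 : ((T N).card : ℝ) + (T N).card ≤
        ((T N).filter fun t => t + e j ∈ T N).card + (T (N + 1)).card := by
      exact_mod_cast (by omega)
    linarith

/-- The condition on the supports of the elements of `A` says that the subgroup spanned by `A` and
the standard basis vectors with index in `F` contains no further standard basis vector. -/
theorem forall_card_ne_one_or_iff_exists_addSubgroup {ι : Type*} [Fintype ι] [DecidableEq ι]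
    (A : AddSubgroup (ι → ℤ)) (F : Finset ι) :
    (∀ a ∈ A, (Finset.univ.filter (fun i => a i ≠ 0) \ F).card ≠ 1 ∨
        ∃ j, Finset.univ.filter (fun i => a i ≠ 0) \ F = {j} ∧ |a j| ≠ 1) ↔
      ∃ L : AddSubgroup (ι → ℤ), A ≤ L ∧ ∀ j, j ∈ F ↔ (Pi.single j 1 : ι → ℤ) ∈ L := by
  constructor
  · intro h
    refine ⟨A ⊔ AddSubgroup.closure ((fun j => (Pi.single j 1 : ι → ℤ)) '' F), le_sup_left,
      fun j => ⟨fun hj => (le_sup_right : _ ≤ A ⊔ _) (AddSubgroup.subset_closure ⟨j, hj, rfl⟩),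
        fun hj => ?_⟩⟩
    by_contra hjF
    obtain ⟨a, ha, b, hb, hab⟩ := AddSubgroup.mem_sup.1 hj
    have hb0 : ∀ i ∉ F, b i = 0 := by
      intro i hi
      have : AddSubgroup.closure ((fun j => (Pi.single j 1 : ι → ℤ)) '' F) ≤
          (Pi.evalAddMonoidHom (fun _ : ι => ℤ) i).ker := by
        rw [AddSubgroup.closure_le]
        rintro _ ⟨k, hk, rfl⟩
        have : i ≠ k := by rintro rfl; exact hi hk
        simp [AddMonoidHom.mem_ker, this]
      simpa [AddMonoidHom.mem_ker] using this hb
    have ha0 : ∀ i ∉ F, a i = (Pi.single j 1 : ι → ℤ) i := by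
      intro i hi
      rw [← hab, Pi.add_apply, hb0 i hi, add_zero]
    have hset : Finset.univ.filter (fun i => a i ≠ 0) \ F = {j} := by
      ext i
      simp only [Finset.mem_sdiff, Finset.mem_filter, Finset.mem_univ, true_and,
        Finset.mem_singleton]
      constructor
      · rintro ⟨h1, h2⟩
        by_contra h3
        exact h1 (by rw [ha0 i h2]; simp [h3])
      · rintro rfl
        exact ⟨by rw [ha0 i hjF]; simp, hjF⟩
    rcases h a ha with h | ⟨k, hk, hk1⟩
    · exact h (by rw [hset]; simp)
    · rw [hset, Finset.singleton_inj] at hk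
      subst hk
      exact hk1 (by rw [ha0 j hjF]; simp)
  · rintro ⟨L, hAL, hL⟩ a ha
    by_contra! hcon
    obtain ⟨j, hj⟩ := Finset.card_eq_one.1 hcon.1
    have haj := hcon.2 j hj
    have hjm : j ∈ Finset.univ.filter (fun i => a i ≠ 0) \ F := by simp [hj]
    have hjF : j ∉ F := (Finset.mem_sdiff.1 hjm).2
    apply hjF
    rw [hL]
    have hsum : (∑ i ∈ F, a i • (Pi.single i 1 : ι → ℤ)) + a j • Pi.single j 1 = a := by
      ext i
      simp only [Pi.add_apply, Finset.sum_apply, Pi.smul_apply, smul_eq_mul, Pi.single_apply,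
        mul_ite, mul_one, mul_zero, Finset.sum_ite_eq]
      by_cases hi : i ∈ F
      · have : i ≠ j := by rintro rfl; exact hjF hi
        simp [hi, this]
      · by_cases hij : i = j
        · subst hij; simp [hi]
        · have h0 : a i = 0 := by
            by_contra h0
            have : i ∈ Finset.univ.filter (fun i => a i ≠ 0) \ F := by simp [h0, hi]
            rw [hj] at this
            exact hij (by simpa using this)
          simp [hi, hij, h0]
    have hmem : a j • (Pi.single j 1 : ι → ℤ) ∈ L := by
      have h1 : ∑ i ∈ F, a i • (Pi.single i 1 : ι → ℤ) ∈ L :=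
        sum_mem fun i hi => zsmul_mem ((hL i).1 hi) _
      rw [← L.add_mem_cancel_left h1, hsum]
      exact hAL ha
    rcases (abs_eq (by norm_num)).1 haj with h | h
    · simpa [h] using hmem
    · simpa [h] using hmem

theorem AddGroup.residuallyFinite_of_fg (G : Type*) [AddCommGroup G] [AddGroup.FG G] :
    AddGroup.ResiduallyFinite G := by
  obtain ⟨n, ι, _, p, hp, e, ⟨f⟩⟩ := AddCommGroup.equiv_free_prod_directSum_zmod G
  classical
  rw [AddGroup.residuallyFinite_iff_exists_finiteIndex]
  intro g hg
  have key : ∃ (m : ℕ) (_ : m ≠ 0) (χ : G →+ ZMod m), χ g ≠ 0 := by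
    by_cases h1 : (f g).1 = 0
    · have h2 : (f g).2 ≠ 0 := fun h2 => hg (f.map_eq_zero_iff.1 (Prod.ext h1 h2))
      obtain ⟨i, hi⟩ := DFinsupp.ne_iff.1 h2
      exact ⟨p i ^ e i, pow_ne_zero _ (hp i).ne_zero,
        ((DFinsupp.evalAddMonoidHom (β := fun i => ZMod (p i ^ e i)) i).comp
          (AddMonoidHom.snd _ _)).comp f.toAddMonoidHom, hi⟩
    · obtain ⟨i, hi⟩ := Finsupp.ne_iff.1 h1
      -- a nonzero integer `a` is not divisible by `|a| + 1`
      refine ⟨((f g).1 i).natAbs + 1, by omega,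
        (((Int.castAddHom (ZMod (((f g).1 i).natAbs + 1))).comp (Finsupp.applyAddHom i)).comp
          (AddMonoidHom.fst _ _)).comp f.toAddMonoidHom, ?_⟩
      simp only [AddMonoidHom.coe_comp, Function.comp_apply, AddEquiv.toAddMonoidHom_eq_coe,
        AddMonoidHom.coe_coe, AddMonoidHom.coe_fst, Finsupp.applyAddHom_apply,
        Int.coe_castAddHom, ne_eq]
      rw [ZMod.intCast_zmod_eq_zero_iff_dvd]
      intro hd
      have := Int.natAbs_le_of_dvd_ne_zero hd (by simpa using hi)
      omega
  -- the kernel of a character of finite order that does not kill `g`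
  obtain ⟨m, hm, χ, hχ⟩ := key
  have : NeZero m := ⟨hm⟩
  exact ⟨χ.ker, AddSubgroup.finiteIndex_ker χ, by simpa using hχ⟩

theorem exists_finiteIndex_le_of_notMem {G ι : Type*} [AddCommGroup G] [AddGroup.FG G]
    (L : AddSubgroup G) (x : ι → G) (s : Finset ι) (hx : ∀ i ∈ s, x i ∉ L) :
    ∃ K : AddSubgroup G, K.FiniteIndex ∧ L ≤ K ∧ ∀ i ∈ s, x i ∉ K := by
  classical
  induction s using Finset.induction_on with
  | empty => exact ⟨⊤, inferInstance, le_top, by simp⟩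
  | insert i s hi ih =>
    obtain ⟨K, hK, hLK, hKx⟩ := ih fun i hi => hx i (Finset.mem_insert_of_mem hi)
    have hfg : AddGroup.FG (G ⧸ L) := inferInstance
    obtain ⟨K', hK', hx'⟩ := AddGroup.residuallyFinite_iff_exists_finiteIndex.1
      (AddGroup.residuallyFinite_of_fg (G ⧸ L)) (QuotientAddGroup.mk (x i))
      (by rw [ne_eq, QuotientAddGroup.eq_zero_iff]; exact hx i (Finset.mem_insert_self _ _))
    have hfin : (K'.comap (QuotientAddGroup.mk' L)).FiniteIndex :=
      ⟨by
        rw [AddSubgroup.index_comap_of_surjective _ (QuotientAddGroup.mk'_surjective L)]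
        exact hK'.index_ne_zero⟩
    refine ⟨K ⊓ K'.comap (QuotientAddGroup.mk' L), inferInstance, le_inf hLK ?_, ?_⟩
    · intro y hy
      have : (QuotientAddGroup.mk y : G ⧸ L) = 0 := (QuotientAddGroup.eq_zero_iff y).2 hy
      simp [this, AddSubgroup.mem_comap, K'.zero_mem]
    · intro k hk hkm
      rcases Finset.mem_insert.1 hk with rfl | hk
      · exact hx' hkm.2
      · exact hKx k hk hkm.1

/-! ### Positive definite sequences and Riesz products -/

/-- A sequence on `ℤ` is positive definite if it is Hermitian and all the matrices
`(g (x j - x i))` are positive semidefinite. The points `x i` need not be distinct, and the index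
type is arbitrary (in `Type`), so that a product of index sets can be used directly. -/
def IsPosDef (g : ℤ → ℂ) : Prop :=
  (∀ m, g (-m) = star (g m)) ∧
  ∀ {ι : Type} (s : Finset ι) (x : ι → ℤ) (z : ι → ℂ),
    0 ≤ (∑ i ∈ s, ∑ j ∈ s, star (z i) * z j * g (x j - x i)).re

theorem sum_sum_star_mul_inner {ι E : Type*} [SeminormedAddCommGroup E] [InnerProductSpace ℂ E]
    (s : Finset ι) (z : ι → ℂ) (v : ι → E) :
    ∑ i ∈ s, ∑ j ∈ s, star (z i) * z j * inner ℂ (v i) (v j) =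
      (‖∑ i ∈ s, z i • v i‖ : ℂ) ^ 2 := by
  refine Eq.trans ?_ (inner_self_eq_norm_sq_to_K (𝕜 := ℂ) _)
  rw [sum_inner]
  refine Finset.sum_congr rfl fun i _ => ?_
  rw [inner_sum]
  refine Finset.sum_congr rfl fun j _ => ?_
  rw [inner_smul_left, inner_smul_right]
  simp [mul_assoc]

theorem isPosDef_single_zero : IsPosDef (Pi.single 0 1) := by
  refine ⟨fun m => ?_, fun s x z => ?_⟩
  · by_cases h : m = 0 <;> simp [h]
  · let b : HilbertBasis ℤ ℂ (lp (fun _ : ℤ => ℂ) 2) := default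
    have hb := orthonormal_iff_ite.1 b.orthonormal
    have h : ∀ i j, (Pi.single 0 1 : ℤ → ℂ) (x j - x i) = inner ℂ (b (x i)) (b (x j)) := by
      intro i j
      rw [hb, Pi.single_apply]
      simp only [sub_eq_zero, eq_comm]
    simp only [h, sum_sum_star_mul_inner s z fun i => b (x i)]
    norm_cast
    positivity

/-- The Fourier coefficients of the product of a trigonometric series with coefficients `g` and
the polynomial `|T|⁻¹ * |∑ t ∈ T, z ^ μ t| ^ 2`. -/
noncomputable def differenceAverage {Q : Type*} (T : Finset Q) (μ : Q → ℤ) (g : ℤ → ℂ)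
    (m : ℤ) : ℂ :=
  (T.card : ℂ)⁻¹ * ∑ t ∈ T, ∑ t' ∈ T, g (m + μ t' - μ t)

theorem IsPosDef.differenceAverage {Q : Type} {g : ℤ → ℂ} (hg : IsPosDef g) (T : Finset Q)
    (μ : Q → ℤ) :
    IsPosDef (differenceAverage T μ g) := by
  refine ⟨fun m => ?_, fun s x z => ?_⟩
  · simp only [_root_.differenceAverage, star_mul', star_sum, star_inv₀, star_natCast]
    rw [Finset.sum_comm]
    congr 1
    refine Finset.sum_congr rfl fun t _ => Finset.sum_congr rfl fun t' _ => ?_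
    rw [← hg.1]
    congr 1; ring
  · have h := hg.2 (s ×ˢ T) (fun p => x p.1 + μ p.2) (fun p => z p.1)
    have e : ∑ i ∈ s, ∑ j ∈ s, star (z i) * z j * _root_.differenceAverage T μ g (x j - x i) =
        ((T.card : ℝ)⁻¹ : ℝ) * ∑ p ∈ s ×ˢ T, ∑ q ∈ s ×ˢ T,
          star (z p.1) * z q.1 * g ((x q.1 + μ q.2) - (x p.1 + μ p.2)) := by
      simp only [Finset.sum_product, _root_.differenceAverage, Finset.mul_sum]
      refine Finset.sum_congr rfl fun i _ => ?_
      rw [Finset.sum_comm]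
      refine Finset.sum_congr rfl fun t _ => Finset.sum_congr rfl fun j _ =>
        Finset.sum_congr rfl fun t' _ => ?_
      have : x j - x i + μ t' - μ t = x j + μ t' - (x i + μ t) := by ring
      rw [this]
      push_cast
      ring
    rw [e, Complex.re_ofReal_mul]
    exact mul_nonneg (by positivity) h

/-- If the frequencies `μ t - μ t'` with `t, t' ∈ T` either equal `p`, namely when `t = t' + e`, or
are far away from `p`, then `differenceAverage T μ g` reproduces `g` near `p`, multiplied by the
proportion of the elements of `T` that stay in `T` when translated by `e`. -/
theorem differenceAverage_add {Q : Type*} [AddGroup Q] [DecidableEq Q] (T : Finset Q) (μ : Q → ℤ)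
    {g : ℤ → ℂ} {M k p : ℤ} {e : Q} (hM : ∀ m, M < |m| → g m = 0)
    (h0 : ∀ t ∈ T, ∀ t' ∈ T, t = t' + e → p + μ t' - μ t = 0)
    (h1 : ∀ t ∈ T, ∀ t' ∈ T, t ≠ t' + e → M + k < |p + μ t' - μ t|) {m : ℤ} (hm : |m| ≤ k) :
    differenceAverage T μ g (p + m) =
      (T.card : ℂ)⁻¹ * (T.filter fun t => t + e ∈ T).card * g m := by
  have key : ∀ t' ∈ T, ∑ t ∈ T, g (p + m + μ t' - μ t) = if t' + e ∈ T then g m else 0 := by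
    intro t' ht'
    rw [← Finset.sum_ite_eq' T (t' + e) fun _ => g m]
    refine Finset.sum_congr rfl fun t ht => ?_
    split_ifs with h
    · have := h0 t ht t' ht' h
      congr 1
      linarith
    · apply hM
      have h2 := h1 t ht t' ht' h
      have h3 := abs_sub_abs_le_abs_sub (p + μ t' - μ t) (-m)
      rw [abs_neg, sub_neg_eq_add] at h3
      have h4 : p + m + μ t' - μ t = p + μ t' - μ t + m := by ring
      rw [h4]
      linarith
  rw [differenceAverage, Finset.sum_comm, Finset.sum_congr rfl key, Finset.sum_ite]
  simp [mul_assoc]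

/-- Dependent choice for an invariant `P` and a relation `R` between consecutive terms. -/
theorem exists_sequence_of_step {α : Type*} (P : ℕ → α → Prop) (R : ℕ → α → α → Prop)
    (h0 : ∃ s, P 0 s) (hs : ∀ k s, P k s → ∃ s', P (k + 1) s' ∧ R k s s') :
    ∃ u : ℕ → α, (∀ k, P k (u k)) ∧ ∀ k, R k (u k) (u (k + 1)) := by
  obtain ⟨s, hs0⟩ := h0
  choose f hf using hs
  let v : (k : ℕ) → {s // P k s} := fun k =>
    Nat.rec ⟨s, hs0⟩ (fun k w => ⟨f k w.1 w.2, (hf k w.1 w.2).1⟩) k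
  exact ⟨fun k => (v k).1, fun k => (v k).2, fun k => (hf k (v k).1 (v k).2).2⟩

theorem Adequate.eventually_eq_zero_or_lt {ℓ : ℕ} {φ : Fin ℓ → ℕ → ℤ} (hφ : Adequate φ)
    (a : Fin ℓ → ℤ) (C : ℤ) :
    ∀ᶠ n in atTop, (a ∈ relationGroup φ → ∑ j, a j * φ j n = 0) ∧
      (a ∉ relationGroup φ → C < |∑ j, a j * φ j n|) := by
  by_cases ha : a ∈ relationGroup φ
  · have h : Tendsto (fun n : ℕ => ∑ j, a j * φ j n) atTop (𝓝 0) := ha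
    rw [nhds_discrete, tendsto_pure] at h
    filter_upwards [h] with n hn
    exact ⟨fun _ => hn, fun h => absurd ha h⟩
  · rcases hφ.2 a with h | h
    · exact absurd ((tendsto_zero_iff_abs_tendsto_zero _).2 h) ha
    · filter_upwards [h.eventually_gt_atTop C] with n hn
      exact ⟨fun h => absurd h ha, fun _ => hn⟩

/-- One factor of the Riesz product. The new coefficients `g'` agree with `g` on `[-M, M]`, which
contains the support of `g`, and around `φ j n` they are a multiple of `g`, with a factor `ρ` that
is `0` for `j ∉ F` and close to `1` for `j ∈ F`. -/
theorem Adequate.exists_posDef_step {ℓ : ℕ} {φ : Fin ℓ → ℕ → ℤ} (hφ : Adequate φ)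
    {F : Finset (Fin ℓ)} {L : AddSubgroup (Fin ℓ → ℤ)} (hAL : relationGroup φ ≤ L)
    (hL : ∀ j, j ∈ F ↔ (Pi.single j 1 : Fin ℓ → ℤ) ∈ L)
    {g : ℤ → ℂ} (hg : IsPosDef g) {M : ℤ} (hM : ∀ m, M < |m| → g m = 0) (k N : ℕ)
    {ε : ℝ} (hε : 0 < ε) :
    ∃ (g' : ℤ → ℂ) (n : ℕ), IsPosDef g' ∧ (∃ M', ∀ m, M' < |m| → g' m = 0) ∧ N < n ∧
      (∀ m, |m| ≤ M → g' m = g m) ∧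
      ∀ j, ∃ ρ : ℂ, (j ∉ F → ρ = 0) ∧ (j ∈ F → ‖ρ - 1‖ ≤ ε) ∧
        ∀ m : ℤ, |m| ≤ k → g' (φ j n + m) = ρ * g m := by
  classical
  let Q := (Fin ℓ → ℤ) ⧸ relationGroup φ
  let e : Fin ℓ → Q := fun j => QuotientAddGroup.mk (Pi.single j 1)
  obtain ⟨T, hTne, hTcl, hT⟩ := exists_finset_almost_invariant e F hε
  let ev : (Fin ℓ → ℤ) → ℕ → ℤ := fun a n => ∑ j, a j * φ j n
  have hev_add : ∀ a b n, ev (a + b) n = ev a n + ev b n := fun a b n => by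
    simp [ev, add_mul, Finset.sum_add_distrib]
  have hev_sub : ∀ a b n, ev (a - b) n = ev a n - ev b n := fun a b n => by
    simp [ev, sub_mul, Finset.sum_sub_distrib]
  have hev_single : ∀ j n, ev (Pi.single j 1) n = φ j n := fun j n => by
    simp [ev, Pi.single_apply]
  have hout : ∀ t : Q, (QuotientAddGroup.mk t.out : Q) = t := fun t => Quotient.out_eq' t
  have hmem : ∀ (a : Fin ℓ → ℤ) (t t' : Q),
      a + t'.out - t.out ∈ relationGroup φ ↔ t = t' + QuotientAddGroup.mk a := by
    intro a t t'
    rw [← QuotientAddGroup.eq_zero_iff, QuotientAddGroup.mk_sub, QuotientAddGroup.mk_add,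
      hout, hout, sub_eq_zero, eq_comm, add_comm]
  -- `none` stands for the translation by `0`, needed for `g' = g` on `[-M, M]`
  have hall : ∀ᶠ n in atTop, ∀ t ∈ T, ∀ t' ∈ T, ∀ o : Option (Fin ℓ),
      let a : Fin ℓ → ℤ := o.elim 0 fun j => Pi.single j 1
      (a + t'.out - t.out ∈ relationGroup φ → ev (a + t'.out - t.out) n = 0) ∧
      (a + t'.out - t.out ∉ relationGroup φ →
        M + max M k < |ev (a + t'.out - t.out) n|) := by
    simp only [Finset.eventually_all, eventually_all]
    intro t _ t' _ o
    exact hφ.eventually_eq_zero_or_lt _ _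
  obtain ⟨n, hn, hNn⟩ := (hall.and (eventually_gt_atTop N)).exists
  let μ : Q → ℤ := fun t => ev t.out n
  have hc : (T.card : ℂ) ≠ 0 := by simpa using hTne.ne_empty
  refine ⟨differenceAverage T μ g, n, hg.differenceAverage T μ, ?_, hNn, ?_, ?_⟩
  · refine ⟨M + ∑ t ∈ T, ∑ t' ∈ T, |μ t' - μ t|, fun m hm => ?_⟩
    rw [differenceAverage, Finset.sum_eq_zero, mul_zero]
    intro t ht
    refine Finset.sum_eq_zero fun t' ht' => hM _ ?_
    have h1 : |μ t' - μ t| ≤ ∑ t ∈ T, ∑ t' ∈ T, |μ t' - μ t| :=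
      (Finset.single_le_sum (f := fun t' => |μ t' - μ t|) (fun _ _ => abs_nonneg _) ht').trans
        (Finset.single_le_sum (f := fun t => ∑ t' ∈ T, |μ t' - μ t|)
          (fun _ _ => Finset.sum_nonneg fun _ _ => abs_nonneg _) ht)
    have h2 := abs_sub_abs_le_abs_sub m (-(μ t' - μ t))
    rw [abs_neg, sub_neg_eq_add, ← add_sub_assoc] at h2
    linarith
  · intro m hm
    have h := differenceAverage_add T μ (g := g) (M := M) (k := M) (p := 0) (e := 0) hM ?_ ?_ hm
    · rw [zero_add] at h
      rw [h]
      simp [hc]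
    · intro t ht t' ht' htt
      have := (hn t ht t' ht' none).1 ((hmem _ _ _).2 (by simpa using htt))
      simpa [hev_sub, μ] using this
    · intro t ht t' ht' htt
      have := (hn t ht t' ht' none).2 (fun h => htt (by simpa using (hmem _ _ _).1 h))
      simp only [Option.elim, zero_add, hev_sub] at this ⊢
      exact lt_of_le_of_lt (by gcongr; exact le_max_left _ _) this
  · intro j
    refine ⟨(T.card : ℂ)⁻¹ * (T.filter fun t => t + e j ∈ T).card, ?_, ?_, ?_⟩
    · intro hj
      rw [Finset.filter_false_of_mem, Finset.card_empty, Nat.cast_zero, mul_zero]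
      intro t ht hte
      apply hj
      rw [hL]
      -- a difference of two elements of `T` lies in the image of `L`, which contains the relations
      have h1 : e j ∈ AddSubgroup.closure (e '' F) := by
        simpa using sub_mem (hTcl _ hte) (hTcl _ ht)
      have h2 : AddSubgroup.closure (e '' F) ≤ L.map (QuotientAddGroup.mk' (relationGroup φ)) := by
        rw [AddSubgroup.closure_le]
        rintro _ ⟨i, hi, rfl⟩
        exact ⟨_, (hL i).1 hi, rfl⟩
      obtain ⟨b, hb, hbe⟩ := h2 h1
      have h3 := hAL (QuotientAddGroup.eq.1 hbe)
      simpa using add_mem hb h3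
    · intro hj
      have h1 := hT j hj
      have hpos : (0 : ℝ) < T.card := by exact_mod_cast hTne.card_pos
      have h2 : ((T.filter fun t => t + e j ∈ T).card : ℝ) ≤ T.card := by
        exact_mod_cast Finset.card_filter_le _ _
      have h3 : (T.card : ℂ)⁻¹ * ((T.filter fun t => t + e j ∈ T).card : ℂ) - 1 =
          (((T.card : ℝ)⁻¹ * ((T.filter fun t => t + e j ∈ T).card : ℝ) - 1 : ℝ) : ℂ) := by
        push_cast; ring
      rw [h3, Complex.norm_real, Real.norm_eq_abs, abs_le, inv_mul_eq_div]
      have h4 : ((T.filter fun t => t + e j ∈ T).card : ℝ) / T.card ≤ 1 :=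
        div_le_one_of_le₀ h2 hpos.le
      have h5 : 1 - ε ≤ ((T.filter fun t => t + e j ∈ T).card : ℝ) / T.card := by
        rwa [le_div_iff₀ hpos]
      constructor <;> linarith
    · intro m hm
      refine differenceAverage_add T μ hM ?_ ?_ hm
      · intro t ht t' ht' htt
        have := (hn t ht t' ht' (some j)).1 ((hmem _ _ _).2 htt)
        simpa [hev_sub, hev_add, hev_single, μ] using this
      · intro t ht t' ht' htt
        have := (hn t ht t' ht' (some j)).2 (fun h => htt ((hmem _ _ _).1 h))
        simp only [Option.elim, hev_add, hev_sub, hev_single] at this ⊢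
        exact lt_of_le_of_lt (by gcongr; exact le_max_right _ _) this

/-- The Fourier coefficients of the Riesz product, that is, of a probability measure on the circle.
They are the eventual values of the coefficients of the partial products. -/
theorem Adequate.exists_posDef {ℓ : ℕ} {φ : Fin ℓ → ℕ → ℤ} (hφ : Adequate φ)
    {F : Finset (Fin ℓ)} {L : AddSubgroup (Fin ℓ → ℤ)} (hAL : relationGroup φ ≤ L)
    (hL : ∀ j, j ∈ F ↔ (Pi.single j 1 : Fin ℓ → ℤ) ∈ L) :
    ∃ (c : ℤ → ℂ) (n : ℕ → ℕ), IsPosDef c ∧ c 0 = 1 ∧ StrictMono n ∧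
      ∀ j m, Tendsto (fun k => c (φ j (n k) + m)) atTop (𝓝 (if j ∈ F then c m else 0)) := by
  -- The state `(g, M, n)` holds the coefficients `g` of a partial product, a bound `M` beyond which
  -- `g` vanishes and below which later factors change nothing, and the last index `n` used.
  obtain ⟨u, hP, hR⟩ := exists_sequence_of_step (α := (ℤ → ℂ) × ℤ × ℕ)
    (fun k s => IsPosDef s.1 ∧ (∀ m, s.2.1 < |m| → s.1 m = 0) ∧ k ≤ s.2.1 ∧ s.1 0 = 1)
    (fun k s s' => s.2.2 < s'.2.2 ∧ s.2.1 ≤ s'.2.1 ∧ (∀ m, |m| ≤ s.2.1 → s'.1 m = s.1 m) ∧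
      ∀ j, |φ j s'.2.2| + k ≤ s'.2.1 ∧
        ∃ ρ : ℂ, (j ∉ F → ρ = 0) ∧ (j ∈ F → ‖ρ - 1‖ ≤ 1 / ((k : ℝ) + 1)) ∧
        ∀ m : ℤ, |m| ≤ k → s'.1 (φ j s'.2.2 + m) = ρ * s.1 m)
    ⟨(Pi.single 0 1, 0, 0), isPosDef_single_zero, fun m hm => by
      have : m ≠ 0 := by rintro rfl; simp at hm
      simp [this], by simp, by simp⟩ (by
    rintro k ⟨g, M, N⟩ ⟨hg, hM, hkM, hg0⟩
    obtain ⟨g', n, hg', ⟨M', hM'⟩, hn, hgg, hj⟩ :=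
      hφ.exists_posDef_step hAL hL hg hM k N (ε := 1 / ((k : ℝ) + 1)) (by positivity)
    have hsum : 0 ≤ ∑ j, |φ j n| := Finset.sum_nonneg fun _ _ => abs_nonneg _
    have hkM' : (k : ℤ) ≤ M := hkM
    refine ⟨(g', max M' M + ∑ j, |φ j n| + (k + 1), n), ⟨hg', fun m hm => hM' m ?_, ?_, ?_⟩,
      hn, ?_, hgg, fun j => ⟨?_, hj j⟩⟩
    · have := le_max_left M' M
      dsimp only at hm
      linarith
    · have := le_max_right M' M
      push_cast
      linarith
    · dsimp only
      rw [hgg 0 (by simp; linarith)]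
      exact hg0
    · have := le_max_right M' M
      dsimp only
      linarith
    · have := le_max_right M' M
      have := Finset.single_le_sum (f := fun j => |φ j n|) (fun _ _ => abs_nonneg _)
        (Finset.mem_univ j)
      dsimp only at this ⊢
      linarith)
  let g : ℕ → ℤ → ℂ := fun k => (u k).1
  let M : ℕ → ℤ := fun k => (u k).2.1
  let n : ℕ → ℕ := fun k => (u k).2.2
  have hMmono : Monotone M := monotone_nat_of_le_succ fun k => (hR k).2.1
  have hstable : ∀ k i, k ≤ i → ∀ m, |m| ≤ M k → g i m = g k m := by
    intro k i hki m hm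
    induction i, hki using Nat.le_induction with
    | base => rfl
    | succ i hki ih => rw [← ih]; exact (hR i).2.2.1 m (hm.trans (hMmono hki))
  let c : ℤ → ℂ := fun m => g m.natAbs m
  have hMk : ∀ k : ℕ, (k : ℤ) ≤ M k := fun k => (hP k).2.2.1
  have hc : ∀ k m, |m| ≤ M k → c m = g k m := by
    intro k m hm
    have hm' : |m| ≤ M m.natAbs := by
      have := hMk m.natAbs
      rwa [Int.natCast_natAbs] at this
    rw [← hstable _ _ (le_max_left k m.natAbs) m hm, hstable _ _ (le_max_right k m.natAbs) m hm']
  refine ⟨c, fun k => n (k + 1), ⟨fun m => ?_, fun s x z => ?_⟩, ?_,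
    strictMono_nat_of_lt_succ fun k => (hR (k + 1)).1, ?_⟩
  · simp only [c, Int.natAbs_neg]
    exact (hP _).1.1 m
  · obtain ⟨k, hk⟩ : ∃ k : ℕ, ∀ i ∈ s, ∀ j ∈ s, |x j - x i| ≤ k := by
      refine ⟨∑ i ∈ s, ∑ j ∈ s, (x j - x i).natAbs, fun i hi j hj => ?_⟩
      rw [← Int.natCast_natAbs]
      exact_mod_cast (Finset.single_le_sum (f := fun j => (x j - x i).natAbs)
        (fun _ _ => Nat.zero_le _) hj).trans
        (Finset.single_le_sum (f := fun i => ∑ j ∈ s, (x j - x i).natAbs)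
          (fun _ _ => Nat.zero_le _) hi)
    have h := (hP k).1.2 s x z
    convert h using 6 with i hi j hj
    exact hc k _ ((hk i hi j hj).trans (hMk k))
  · exact (hP 0).2.2.2
  · intro j m
    have hR' := fun k => ((hR k).2.2.2 j).2
    choose ρ hρ0 hρ1 hρ using hR'
    have hev : ∀ᶠ k in atTop, ρ k * c m = c (φ j (n (k + 1)) + m) := by
      filter_upwards [eventually_ge_atTop m.natAbs] with k hk
      have hmk : |m| ≤ k := by rw [← Int.natCast_natAbs]; exact_mod_cast hk
      rw [hc k m (hmk.trans (hMk k)), hc (k + 1) (φ j (n (k + 1)) + m) ?_]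
      · exact (hρ k m hmk).symm
      · exact (abs_add_le _ _).trans
          ((add_le_add_right hmk _).trans ((hR k).2.2.2 j).1)
    refine Tendsto.congr' hev ?_
    by_cases hj : j ∈ F
    · have h1 : Tendsto ρ atTop (𝓝 1) := by
        rw [tendsto_iff_norm_sub_tendsto_zero]
        exact squeeze_zero (fun _ => norm_nonneg _) (fun k => hρ1 k hj)
          tendsto_one_div_add_atTop_nhds_zero_nat
      simpa [hj] using h1.mul_const (c m)
    · simp [hj, hρ0 _ hj]

/-! ### Unitary operators with prescribed correlations -/

/-- The Gelfand-Naimark-Segal construction: a positive definite sequence `c` is the Gram matrix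
`c (n - m) = ⟪v m, v n⟫` of a total family in a Hilbert space, namely of the basis vectors in the
completion of `ℤ →₀ ℂ` for the semi-inner product with kernel `c`. -/
theorem IsPosDef.exists_gram {c : ℤ → ℂ} (hc : IsPosDef c) :
    ∃ (E : Type) (_ : NormedAddCommGroup E) (_ : InnerProductSpace ℂ E) (_ : CompleteSpace E)
      (v : ℤ → E), (∀ m n, inner ℂ (v m) (v n) = c (n - m)) ∧
        DenseRange (Finsupp.linearCombination ℂ v) := by
  let core : PreInnerProductSpace.Core ℂ (ℤ →₀ ℂ) :=
    { inner := fun f h => f.sum fun m z => h.sum fun n w => star z * w * c (n - m)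
      conj_inner_symm := fun f h => by
        rw [Finsupp.sum_comm]
        simp only [Finsupp.sum, map_sum]
        refine Finset.sum_congr rfl fun n _ => Finset.sum_congr rfl fun m _ => ?_
        have : c (m - n) = star (c (n - m)) := by rw [← hc.1]; congr 1; ring
        rw [this]
        simp [mul_comm]
      re_inner_nonneg := fun f => hc.2 f.support id f
      add_left := fun f g h => by
        rw [Finsupp.sum_add_index'] <;> simp [← Finsupp.sum_add, add_mul]
      smul_left := fun f h r => by
        rw [Finsupp.sum_smul_index] <;> simp [Finsupp.mul_sum, ← mul_assoc] }
  let _ : SeminormedAddCommGroup (ℤ →₀ ℂ) :=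
    InnerProductSpace.Core.toSeminormedAddCommGroup (𝕜 := ℂ) (c := core)
  let _ : InnerProductSpace ℂ (ℤ →₀ ℂ) := .ofCore core
  let ι : (ℤ →₀ ℂ) →ₗ[ℂ] UniformSpace.Completion (ℤ →₀ ℂ) :=
    (UniformSpace.Completion.toComplL (𝕜 := ℂ) (E := ℤ →₀ ℂ)).toLinearMap
  refine ⟨UniformSpace.Completion (ℤ →₀ ℂ), inferInstance, inferInstance, inferInstance,
    fun m => ι (Finsupp.single m 1), fun m n => ?_, ?_⟩
  · change inner ℂ ((Finsupp.single m 1 : ℤ →₀ ℂ) : UniformSpace.Completion (ℤ →₀ ℂ))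
      ((Finsupp.single n 1 : ℤ →₀ ℂ) : UniformSpace.Completion (ℤ →₀ ℂ)) = _
    rw [UniformSpace.Completion.inner_coe]
    change ((Finsupp.single m (1 : ℂ)).sum fun m z => (Finsupp.single n (1 : ℂ)).sum
      fun n w => star z * w * c (n - m)) = _
    simp
  · have : ⇑(Finsupp.linearCombination ℂ fun m => ι (Finsupp.single m 1)) = ι := by
      ext f
      rw [Finsupp.linearCombination_apply]
      conv_rhs => rw [← Finsupp.sum_single f]
      rw [Finsupp.sum, Finsupp.sum, map_sum]
      refine Finset.sum_congr rfl fun m _ => ?_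
      rw [← map_smul, Finsupp.smul_single, smul_eq_mul, mul_one]
    rw [this]
    exact UniformSpace.Completion.denseRange_coe

theorem norm_linearCombination_eq_of_inner_eq {κ E E' : Type*}
    [SeminormedAddCommGroup E] [InnerProductSpace ℂ E]
    [SeminormedAddCommGroup E'] [InnerProductSpace ℂ E'] {v : κ → E} {w : κ → E'}
    (h : ∀ i j, inner ℂ (v i) (v j) = inner ℂ (w i) (w j)) (f : κ →₀ ℂ) :
    ‖Finsupp.linearCombination ℂ v f‖ = ‖Finsupp.linearCombination ℂ w f‖ := by
  have h1 := sum_sum_star_mul_inner f.support f v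
  simp only [h, sum_sum_star_mul_inner f.support f w] at h1
  norm_cast at h1
  exact ((sq_eq_sq₀ (norm_nonneg _) (norm_nonneg _)).1 h1).symm

theorem exists_linearIsometryEquiv_of_inner_eq {κ E E' : Type*}
    [NormedAddCommGroup E] [InnerProductSpace ℂ E] [CompleteSpace E]
    [NormedAddCommGroup E'] [InnerProductSpace ℂ E'] [CompleteSpace E'] {v : κ → E} {w : κ → E'}
    (hv : DenseRange (Finsupp.linearCombination ℂ v))
    (hw : DenseRange (Finsupp.linearCombination ℂ w))
    (h : ∀ i j, inner ℂ (v i) (v j) = inner ℂ (w i) (w j)) :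
    ∃ U : E ≃ₗᵢ[ℂ] E', ∀ i, U (v i) = w i := by
  refine ⟨(LinearEquiv.refl ℂ (κ →₀ ℂ)).extendOfIsometry (Finsupp.linearCombination ℂ v)
    (Finsupp.linearCombination ℂ w) hv hw
    fun f => (norm_linearCombination_eq_of_inner_eq h f).symm, fun i => ?_⟩
  have := LinearEquiv.extendOfIsometry_eq (LinearEquiv.refl ℂ (κ →₀ ℂ)) _ _ hv hw
    (fun f => (norm_linearCombination_eq_of_inner_eq h f).symm) (Finsupp.single i 1)
  simpa using this

theorem denseRange_linearCombination_iff {κ E : Type*} [NormedAddCommGroup E]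
    [InnerProductSpace ℂ E] {v : κ → E} :
    DenseRange (Finsupp.linearCombination ℂ v) ↔
      (Submodule.span ℂ (Set.range v)).topologicalClosure = ⊤ := by
  rw [← Submodule.dense_iff_topologicalClosure_eq_top, ← Finsupp.range_linearCombination,
    DenseRange, LinearMap.coe_range]

theorem HilbertBasis.countable_of_dense {κ β E : Type*} [Countable κ] [NormedAddCommGroup E]
    [InnerProductSpace ℂ E] (b : HilbertBasis β ℂ E) {v : κ → E}
    (hv : DenseRange (Finsupp.linearCombination ℂ v)) : Countable β := by
  have hsupp : ∀ m, {i | inner ℂ (b i) (v m) ≠ 0}.Countable := by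
    intro m
    refine (b.orthonormal.inner_products_summable (v m)).countable_support.mono fun i hi => ?_
    simpa using hi
  rw [← Set.countable_univ_iff]
  refine (Set.countable_iUnion hsupp).mono fun i _ => ?_
  by_contra hi
  simp only [ne_eq, Set.mem_iUnion, Set.mem_ofPred_eq, not_exists, not_not] at hi
  have h0 : b i = 0 := by
    refine hv.eq_zero_of_inner_left ℂ fun f => ?_
    rw [Finsupp.linearCombination_apply, Finsupp.sum, inner_sum]
    exact Finset.sum_eq_zero fun m _ => by rw [inner_smul_right, hi m, mul_zero]
  have := b.orthonormal.ne_zero i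
  exact this h0

theorem nonempty_equiv_prod_of_countable.{u, v} {ι : Type u} {β : Type v} [Infinite ι]
    [Countable β] [Nonempty β] :
    Nonempty (ι ≃ ι × β) := by
  have h : Cardinal.mk (ι × β) = Cardinal.lift.{v} (Cardinal.mk ι) := by
    rw [Cardinal.mk_prod]
    refine Cardinal.mul_eq_left (Cardinal.aleph0_le_lift.2 (Cardinal.aleph0_le_mk ι))
      ((Cardinal.lift_le_aleph0.2 Cardinal.mk_le_aleph0).trans
        (Cardinal.aleph0_le_lift.2 (Cardinal.aleph0_le_mk ι))) ?_
    simp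
  rw [← Cardinal.lift_mk_eq', h]
  simp

/-- Every infinite-dimensional Hilbert space is an orthogonal sum of copies of a given nonzero
separable one: a Hilbert basis of `H` can be reindexed by pairs of one of its elements and an
element of a Hilbert basis of `E`, which is countable. In terms of a total family `v` in `E`, the
copies of `v` form a total family in `H`. -/
theorem exists_orthogonal_copies {H : Type*} [NormedAddCommGroup H] [InnerProductSpace ℂ H]
    [CompleteSpace H] (hH : ¬ FiniteDimensional ℂ H) {κ E : Type*} [Countable κ]
    [NormedAddCommGroup E] [InnerProductSpace ℂ E] [CompleteSpace E] [Nontrivial E] {v : κ → E}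
    (hv : DenseRange (Finsupp.linearCombination ℂ v)) :
    ∃ (ι : Set H) (w : ι × κ → H), DenseRange (Finsupp.linearCombination ℂ w) ∧
      ∀ p q, inner ℂ (w p) (w q) = open Classical in
        if p.1 = q.1 then inner ℂ (v p.2) (v q.2) else 0 := by
  classical
  obtain ⟨β, b, hb⟩ := exists_hilbertBasis ℂ E
  obtain ⟨ι, a, ha⟩ := exists_hilbertBasis ℂ H
  have : Countable β := b.countable_of_dense hv
  have : Nonempty β := by
    by_contra hβ
    rw [not_nonempty_iff] at hβ
    have := b.repr.toEquiv.subsingleton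
    exact not_subsingleton E this
  have : Infinite ι := by
    by_contra hι
    rw [not_infinite_iff_finite] at hι
    have := Fintype.ofFinite ι
    exact hH a.toOrthonormalBasis.toBasis.finiteDimensional_of_finite
  obtain ⟨σ⟩ := nonempty_equiv_prod_of_countable (ι := ι) (β := β)
  have horth : ∀ i, Orthonormal ℂ fun k : β => a (σ.symm (i, k)) := fun i =>
    a.orthonormal.comp _ (σ.symm.injective.comp (Prod.mk_right_injective i))
  let V : ι → E →ₗᵢ[ℂ] H := fun i =>
    (horth i).orthogonalFamily.linearIsometry.comp b.repr.toLinearIsometry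
  have hVb : ∀ i k, V i (b k) = a (σ.symm (i, k)) := by
    intro i k
    change (horth i).orthogonalFamily.linearIsometry (b.repr (b k)) = _
    rw [b.repr_self, OrthogonalFamily.linearIsometry_apply_single]
    simp
  -- membership of the range of `V i` in closed subspaces can be tested on the basis `b`
  have hspan : ∀ (i : ι) (x : E) (s : Submodule ℂ H), IsClosed (s : Set H) →
      (∀ k, V i (b k) ∈ s) → V i x ∈ s := by
    intro i x s hs h
    have h1 : (Submodule.span ℂ (Set.range b)).topologicalClosure ≤
        s.comap (V i).toLinearMap := by
      refine Submodule.topologicalClosure_minimal _ (Submodule.span_le.2 ?_)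
        (hs.preimage (V i).continuous)
      rintro _ ⟨k, rfl⟩
      exact h k
    rw [b.dense_span] at h1
    exact h1 (Submodule.mem_top (x := x))
  have hVV : ∀ i j, i ≠ j → ∀ x y, inner ℂ (V i x) (V j y) = 0 := by
    intro i j hij x y
    rw [← Submodule.mem_orthogonal_singleton_iff_inner_right (𝕜 := ℂ)]
    refine hspan j y _ (Submodule.isClosed_orthogonal _) fun k => ?_
    rw [Submodule.mem_orthogonal_singleton_iff_inner_right,
      ← Submodule.mem_orthogonal_singleton_iff_inner_left]
    refine hspan i x _ (Submodule.isClosed_orthogonal _) fun l => ?_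
    rw [Submodule.mem_orthogonal_singleton_iff_inner_left, hVb, hVb]
    exact a.orthonormal.inner_eq_zero fun h =>
      hij (congrArg Prod.fst (σ.symm.injective h))
  refine ⟨ι, fun p => V p.1 (v p.2), ?_, ?_⟩
  · rw [denseRange_linearCombination_iff] at hv ⊢
    set S := (Submodule.span ℂ (Set.range fun p : ι × κ => V p.1 (v p.2))).topologicalClosure
      with hS
    have hScl : IsClosed (S : Set H) := Submodule.isClosed_topologicalClosure _
    have h1 : ∀ i x, V i x ∈ S := by
      intro i x
      have h2 : (Submodule.span ℂ (Set.range v)).topologicalClosure ≤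
          S.comap (V i).toLinearMap := by
        refine Submodule.topologicalClosure_minimal _ (Submodule.span_le.2 ?_)
          (hScl.preimage (V i).continuous)
        rintro _ ⟨m, rfl⟩
        exact Submodule.le_topologicalClosure _ (Submodule.subset_span ⟨(i, m), rfl⟩)
      rw [hv] at h2
      exact h2 (Submodule.mem_top (x := x))
    rw [eq_top_iff, ← a.dense_span]
    refine Submodule.topologicalClosure_minimal _ (Submodule.span_le.2 ?_) hScl
    rintro _ ⟨x, rfl⟩
    rw [← σ.symm_apply_apply x, ← hVb]
    exact h1 _ _
  · rintro ⟨i, m⟩ ⟨j, n⟩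
    by_cases h : i = j
    · subst h; simp
    · simp [h, hVV i j h]

/-- The shift of the total family `w` is a unitary operator on `H`, an orthogonal sum of copies of
the cyclic unitary operator with correlation sequence `c`. -/
theorem IsPosDef.exists_unitary {H : Type*} [NormedAddCommGroup H] [InnerProductSpace ℂ H]
    [CompleteSpace H] (hH : ¬ FiniteDimensional ℂ H) {c : ℤ → ℂ} (hc : IsPosDef c)
    (hc0 : c 0 = 1) :
    ∃ (ι : Set H) (w : ι × ℤ → H) (U : H ≃ₗᵢ[ℂ] H),
      (Submodule.span ℂ (Set.range w)).topologicalClosure = ⊤ ∧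
      (∀ p q, inner ℂ (w p) (w q) = open Classical in
        if p.1 = q.1 then c (q.2 - p.2) else 0) ∧
      ∀ i m n, (U ^ n) (w (i, m)) = w (i, m + n) := by
  obtain ⟨E, _, _, _, v, hvc, hv⟩ := hc.exists_gram
  have : Nontrivial E := by
    refine ⟨v 0, 0, fun h => ?_⟩
    have := hvc 0 0
    simp [h, hc0] at this
  obtain ⟨ι, w, hw, hwv⟩ := exists_orthogonal_copies hH hv
  simp only [hvc] at hwv
  have hw' : DenseRange (Finsupp.linearCombination ℂ fun p : ι × ℤ => w (p.1, p.2 + 1)) := by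
    rw [denseRange_linearCombination_iff] at hw ⊢
    convert hw using 3
    refine (((Equiv.refl ι).prodCongr (Equiv.addRight (1 : ℤ))).surjective.range_comp w)
  obtain ⟨U, hU⟩ := exists_linearIsometryEquiv_of_inner_eq hw hw' fun p q => by
    simp [hwv]
  refine ⟨ι, w, U, denseRange_linearCombination_iff.1 hw, hwv, fun i m n => ?_⟩
  induction n using Int.induction_on generalizing m with
  | zero => simp
  | succ n ih =>
    rw [zpow_add_one, LinearIsometryEquiv.coe_mul, Function.comp_apply, hU (i, m), ih]
    congr 2; ring
  | pred n ih =>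
    have h : U⁻¹ (w (i, m)) = w (i, m - 1) := by
      rw [← LinearIsometryEquiv.symm_apply_apply U (w (i, m - 1)), hU]
      simp
    rw [zpow_sub_one, LinearIsometryEquiv.coe_mul, Function.comp_apply, h, ih]
    congr 2; ring

/-! ### Weak and strong convergence of powers of a unitary operator -/

/-- Weak convergence in a Hilbert space can be tested against vectors, by the Riesz representation
theorem. -/
theorem tendsto_toWeakSpace_iff {H : Type*} [NormedAddCommGroup H] [InnerProductSpace ℂ H]
    [CompleteSpace H] {α : Type*} {l : Filter α} {x : α → H} {y : H} :
    Tendsto (fun k => toWeakSpace ℂ H (x k)) l (𝓝 (toWeakSpace ℂ H y)) ↔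
      ∀ z, Tendsto (fun k => inner ℂ z (x k)) l (𝓝 (inner ℂ z y)) := by
  have hinj : Function.Injective (topDualPairing ℂ H).flip := by
    intro a b hab
    refine ext_inner_left ℂ fun z => ?_
    exact congrArg (fun f => f (InnerProductSpace.toDual ℂ H z)) hab
  refine (WeakBilin.tendsto_iff_forall_eval_tendsto _ hinj).trans ⟨fun h z => ?_, fun h f => ?_⟩
  · exact h (InnerProductSpace.toDual ℂ H z)
  · have := h ((InnerProductSpace.toDual ℂ H).symm f)
    simp only [InnerProductSpace.toDual_symm_apply] at this
    exact this

theorem tendsto_zero_of_total {H : Type*} [SeminormedAddCommGroup H] [NormedSpace ℂ H]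
    {α : Type*} {l : Filter α} {s : Set H} (hs : (Submodule.span ℂ s).topologicalClosure = ⊤)
    {D : α → H →L[ℂ] ℂ} {C : ℝ} (hD : ∀ k, ‖D k‖ ≤ C)
    (h : ∀ x ∈ s, Tendsto (fun k => D k x) l (𝓝 0)) (x : H) :
    Tendsto (fun k => D k x) l (𝓝 0) := by
  have hspan : ∀ y ∈ Submodule.span ℂ s, Tendsto (fun k => D k y) l (𝓝 0) := by
    intro y hy
    induction hy using Submodule.span_induction with
    | mem y hy => exact h y hy
    | zero => simpa using tendsto_const_nhds
    | add y z _ _ hy hz => simpa using hy.add hz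
    | smul c y _ hy => simpa using hy.const_mul c
  have hx : x ∈ closure (Submodule.span ℂ s : Set H) := by
    rw [← Submodule.topologicalClosure_coe, hs]; trivial
  rw [Metric.tendsto_nhds]
  intro ε hε
  have hC : 0 < |C| + 1 := by positivity
  obtain ⟨y, hy, hxy⟩ := Metric.mem_closure_iff.1 hx (ε / 2 / (|C| + 1)) (by positivity)
  filter_upwards [Metric.tendsto_nhds.1 (hspan y hy) (ε / 2) (by positivity)] with k hk
  rw [dist_zero_right] at hk ⊢
  have h1 : ‖D k (x - y)‖ ≤ (|C| + 1) * ‖x - y‖ :=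
    (D k).le_of_opNorm_le ((hD k).trans (by linarith [le_abs_self C])) _
  rw [dist_eq_norm, lt_div_iff₀ hC] at hxy
  calc ‖D k x‖ = ‖D k (x - y) + D k y‖ := by rw [← map_add, sub_add_cancel]
    _ ≤ ‖D k (x - y)‖ + ‖D k y‖ := norm_add_le _ _
    _ < ε := by nlinarith

/-- Weak convergence of unitary operators to a multiple of the identity can be tested on a total
family. -/
theorem tendsto_inner_of_total {H : Type*} [NormedAddCommGroup H] [InnerProductSpace ℂ H]
    {α κ : Type*} {l : Filter α} {w : κ → H}
    (hw : (Submodule.span ℂ (Set.range w)).topologicalClosure = ⊤) (V : α → H ≃ₗᵢ[ℂ] H) (a : ℂ)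
    (h : ∀ p q, Tendsto (fun k => inner ℂ (w p) (V k (w q))) l (𝓝 (a * inner ℂ (w p) (w q))))
    (z f : H) : Tendsto (fun k => inner ℂ z (V k f)) l (𝓝 (inner ℂ z (a • f))) := by
  have hbound : ∀ k x, ‖V k x - a • x‖ ≤ (1 + ‖a‖) * ‖x‖ := fun k x => by
    refine (norm_sub_le _ _).trans ?_
    rw [(V k).norm_map, norm_smul]
    linarith
  let T : α → H →L[ℂ] H := fun k => ((V k).toContinuousLinearEquiv : H →L[ℂ] H) -
    a • ContinuousLinearMap.id ℂ H
  have hT : ∀ k x, T k x = V k x - a • x := fun k x => by simp [T]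
  -- first vary the vector in the second slot, then the one in the first slot
  have h1 : ∀ p f, Tendsto (fun k => inner ℂ (w p) (V k f - a • f)) l (𝓝 0) := by
    intro p f
    have := tendsto_zero_of_total hw (l := l) (D := fun k => (innerSL ℂ (w p)).comp (T k))
      (C := ‖w p‖ * (1 + ‖a‖)) (fun k => ?_) ?_ f
    · simpa only [ContinuousLinearMap.comp_apply, innerSL_apply_apply, hT] using this
    · refine (ContinuousLinearMap.opNorm_comp_le _ _).trans ?_
      rw [innerSL_apply_norm]
      gcongr
      exact ContinuousLinearMap.opNorm_le_bound _ (by positivity)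
        fun x => by rw [hT]; exact hbound k x
    · rintro _ ⟨q, rfl⟩
      have := (h p q).sub_const (a * inner ℂ (w p) (w q))
      simpa [hT, inner_sub_right, inner_smul_right] using this
  have h2 : Tendsto (fun k => inner ℂ (V k f - a • f) z) l (𝓝 0) := by
    refine tendsto_zero_of_total hw (D := fun k => innerSL ℂ (V k f - a • f))
      (C := (1 + ‖a‖) * ‖f‖) (fun k => ?_) ?_ z
    · rw [innerSL_apply_norm]; exact hbound k f
    · rintro _ ⟨p, rfl⟩
      have := (h1 p f).star
      simpa using this
  have h3 := (h2.star).add_const (inner ℂ z (a • f))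
  rw [star_zero, zero_add] at h3
  refine h3.congr fun k => ?_
  rw [Complex.star_def, inner_conj_symm, inner_sub_right, sub_add_cancel]

/-- Weak convergence without change of norm is norm convergence. -/
theorem tendsto_of_tendsto_inner_self {H : Type*} [NormedAddCommGroup H] [InnerProductSpace ℂ H]
    {α : Type*} {l : Filter α} {x : α → H} {f : H} (hx : ∀ k, ‖x k‖ = ‖f‖)
    (h : Tendsto (fun k => inner ℂ f (x k)) l (𝓝 (inner ℂ f f))) : Tendsto x l (𝓝 f) := by
  rw [tendsto_iff_norm_sub_tendsto_zero]
  have h1 : Tendsto (fun k => ‖x k - f‖ ^ 2) l (𝓝 0) := by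
    have h2 : ∀ k, ‖x k - f‖ ^ 2 = 2 * ‖f‖ ^ 2 - 2 * (inner ℂ f (x k)).re := by
      intro k
      rw [norm_sub_rev, @norm_sub_sq ℂ, hx k]
      simp only [RCLike.re_to_complex]
      ring
    simp only [h2]
    have h3 := ((Complex.continuous_re.tendsto _).comp h).const_mul 2
    have h4 := h3.const_sub (2 * ‖f‖ ^ 2)
    have h5 : (inner ℂ f f : ℂ).re = ‖f‖ ^ 2 := inner_self_eq_norm_sq (𝕜 := ℂ) f
    rw [h5, sub_self] at h4
    exact h4
  have h6 := h1.sqrt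
  simpa using h6

/-- The sequences `p` of exponents along which the powers `U ^ p k` tend strongly to the
identity. -/
def rigiditySubgroup {H α : Type*} [NormedAddCommGroup H] [InnerProductSpace ℂ H]
    (U : H ≃ₗᵢ[ℂ] H) (l : Filter α) : AddSubgroup (α → ℤ) where
  carrier := {p | ∀ f, Tendsto (fun k => (U ^ p k) f) l (𝓝 f)}
  zero_mem' := fun f => by simpa using tendsto_const_nhds
  add_mem' := by
    intro p q hp hq f
    have h := (tendsto_iff_norm_sub_tendsto_zero.1 (hq f)).add
      (tendsto_iff_norm_sub_tendsto_zero.1 (hp f))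
    rw [add_zero] at h
    rw [tendsto_iff_norm_sub_tendsto_zero]
    refine squeeze_zero (fun _ => norm_nonneg _) (fun k => ?_) h
    -- `U ^ p k` is isometric, so the error of `U ^ q k` is not enlarged
    calc ‖(U ^ (p + q) k) f - f‖ = ‖(U ^ p k) ((U ^ q k) f - f) + ((U ^ p k) f - f)‖ := by
          rw [Pi.add_apply, zpow_add, LinearIsometryEquiv.coe_mul, Function.comp_apply, map_sub]
          congr 1; abel
      _ ≤ ‖(U ^ p k) ((U ^ q k) f - f)‖ + ‖(U ^ p k) f - f‖ := norm_add_le _ _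
      _ = _ := by rw [LinearIsometryEquiv.norm_map]
  neg_mem' := by
    intro p hp f
    rw [tendsto_iff_norm_sub_tendsto_zero]
    refine (tendsto_iff_norm_sub_tendsto_zero.1 (hp f)).congr fun k => ?_
    rw [← LinearIsometryEquiv.norm_map (U ^ p k) ((U ^ (-p) k) f - f), map_sub, norm_sub_rev]
    congr 2
    rw [← Function.comp_apply (f := (U ^ p k)), ← LinearIsometryEquiv.coe_mul, Pi.neg_apply,
      zpow_neg, mul_inv_cancel, LinearIsometryEquiv.coe_one, id]

theorem exists_addSubgroup_of_tendsto_zpow {H : Type*} [NormedAddCommGroup H]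
    [InnerProductSpace ℂ H] [CompleteSpace H] [Nontrivial H] {ℓ : ℕ} (φ : Fin ℓ → ℕ → ℤ)
    (F : Finset (Fin ℓ)) {n : ℕ → ℕ} (hn : StrictMono n) (U : H ≃ₗᵢ[ℂ] H)
    (hU : ∀ (f : H) (j : Fin ℓ),
      Tendsto (fun k : ℕ => toWeakSpace ℂ H ((U ^ (φ j (n k))) f)) atTop
        (𝓝 (toWeakSpace ℂ H (if j ∈ F then f else 0)))) :
    ∃ L : AddSubgroup (Fin ℓ → ℤ), relationGroup φ ≤ L ∧
      ∀ j, j ∈ F ↔ (Pi.single j 1 : Fin ℓ → ℤ) ∈ L := by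
  let ev : (Fin ℓ → ℤ) →+ (ℕ → ℤ) :=
    { toFun := fun a k => ∑ j, a j * φ j (n k)
      map_zero' := by ext; simp
      map_add' := fun a b => by ext; simp [add_mul, Finset.sum_add_distrib] }
  have hev : ∀ j, ev (Pi.single j 1) = fun k => φ j (n k) := fun j => by
    ext k
    simp [ev, Pi.single_apply]
  refine ⟨(rigiditySubgroup U atTop).comap ev, fun a ha f => ?_, fun j => ?_⟩
  · have h : Tendsto (fun n : ℕ => ∑ j, a j * φ j n) atTop (𝓝 0) := ha
    rw [nhds_discrete, tendsto_pure] at h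
    refine tendsto_const_nhds.congr' ?_
    filter_upwards [hn.tendsto_atTop.eventually h] with k hk
    -- integers tending to `0` are eventually equal to `0`
    have : ev a k = 0 := hk
    simp [this]
  · rw [AddSubgroup.mem_comap, hev]
    constructor
    · intro hj f
      refine tendsto_of_tendsto_inner_self (fun k => LinearIsometryEquiv.norm_map _ _) ?_
      have := tendsto_toWeakSpace_iff.1 (hU f j) f
      simpa [hj] using this
    · intro hj
      by_contra hjF
      obtain ⟨f, hf⟩ := exists_ne (0 : H)
      have h1 := tendsto_toWeakSpace_iff.1 (hU f j) f
      have h2 : Tendsto (fun k => inner ℂ f ((U ^ φ j (n k)) f)) atTop (𝓝 (inner ℂ f f)) :=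
        tendsto_const_nhds.inner (hj f)
      have h3 := tendsto_nhds_unique h1 h2
      simp only [hjF, if_false, inner_zero_right] at h3
      exact hf (inner_self_eq_zero.1 h3.symm)

theorem Adequate.exists_unitary_tendsto_zpow {H : Type*} [NormedAddCommGroup H]
    [InnerProductSpace ℂ H] [CompleteSpace H] (hH : ¬ FiniteDimensional ℂ H)
    {ℓ : ℕ} {φ : Fin ℓ → ℕ → ℤ} (hφ : Adequate φ)
    {F : Finset (Fin ℓ)} {L : AddSubgroup (Fin ℓ → ℤ)} (hAL : relationGroup φ ≤ L)
    (hL : ∀ j, j ∈ F ↔ (Pi.single j 1 : Fin ℓ → ℤ) ∈ L) :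
    ∃ n : ℕ → ℕ, StrictMono n ∧ ∃ U : H ≃ₗᵢ[ℂ] H, ∀ (f : H) (j : Fin ℓ),
      Tendsto (fun k : ℕ => toWeakSpace ℂ H ((U ^ (φ j (n k))) f)) atTop
        (𝓝 (toWeakSpace ℂ H (if j ∈ F then f else 0))) := by
  obtain ⟨c, n, hc, hc0, hn, hlim⟩ := hφ.exists_posDef hAL hL
  obtain ⟨ι, w, U, hw, hinner, hU⟩ := hc.exists_unitary hH hc0
  refine ⟨n, hn, U, fun f j => tendsto_toWeakSpace_iff.2 fun z => ?_⟩
  have h := tendsto_inner_of_total hw (l := atTop) (fun k => U ^ φ j (n k))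
    (if j ∈ F then 1 else 0) ?_ z f
  · simpa using h
  · rintro ⟨i, m⟩ ⟨i', m'⟩
    simp only [hU, hinner]
    by_cases hi : i = i'
    · simp only [hi, if_true, ite_mul, one_mul, zero_mul]
      refine (hlim j (m' - m)).congr fun k => ?_
      congr 1; ring
    · simp [hi]

theorem lemma4
    {H : Type*} [NormedAddCommGroup H] [InnerProductSpace ℂ H] [CompleteSpace H]
    (hH : ¬ FiniteDimensional ℂ H)
    {ℓ : ℕ} (φ : Fin ℓ → ℕ → ℤ) (hφ : Adequate φ) (F : Finset (Fin ℓ)) :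
    List.TFAE [
      -- (a)
      ∃ K : AddSubgroup (Fin ℓ → ℤ), K.FiniteIndex ∧ relationGroup φ ≤ K ∧
        ∀ j : Fin ℓ, j ∈ F ↔ (Pi.single j 1 : Fin ℓ → ℤ) ∈ K,
      -- (b): the limits are taken in the weak topology of `H`
      ∃ n : ℕ → ℕ, StrictMono n ∧ ∃ U : H ≃ₗᵢ[ℂ] H, ∀ (f : H) (j : Fin ℓ),
        Tendsto (fun k : ℕ => toWeakSpace ℂ H ((U ^ (φ j (n k))) f)) atTop
          (𝓝 (toWeakSpace ℂ H (if j ∈ F then f else 0))),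
      -- (c)
      ∀ a ∈ relationGroup φ,
        (Finset.univ.filter (fun i => a i ≠ 0) \ F).card ≠ 1 ∨
        ∃ j : Fin ℓ, Finset.univ.filter (fun i => a i ≠ 0) \ F = {j} ∧ |a j| ≠ 1] := by
  rw [forall_card_ne_one_or_iff_exists_addSubgroup (relationGroup φ) F]
  tfae_have 1 → 3 := fun ⟨K, _, hAK, hK⟩ => ⟨K, hAK, hK⟩
  tfae_have 3 → 1 := by
    rintro ⟨L, hAL, hL⟩
    have : AddGroup.FG (Fin ℓ → ℤ) := Module.Finite.iff_addGroup_fg.1 inferInstance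
    obtain ⟨K, hK, hLK, hKF⟩ := exists_finiteIndex_le_of_notMem L
      (fun j : Fin ℓ => (Pi.single j 1 : Fin ℓ → ℤ)) (Finset.univ \ F)
      fun j hj h => (Finset.mem_sdiff.1 hj).2 ((hL j).2 h)
    refine ⟨K, hK, hAL.trans hLK, fun j => ⟨fun hj => hLK ((hL j).1 hj), fun hj => ?_⟩⟩
    by_contra hjF
    exact hKF j (by simpa using hjF) hj
  tfae_have 2 → 3 := by
    rintro ⟨n, hn, U, hU⟩
    have : Nontrivial H := by
      by_contra h
      rw [not_nontrivial_iff_subsingleton] at h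
      exact hH inferInstance
    exact exists_addSubgroup_of_tendsto_zpow φ F hn U hU
  tfae_have 3 → 2 := fun ⟨_, hAL, hL⟩ => hφ.exists_unitary_tendsto_zpow hH hAL hL
  tfae_finish
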